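/- Let the Euler polynomials $E_k(x)\in\mathbb{Q}[x]$ be defined by $\sum_{k\ge 0}E_k(x)\frac{t^k}{k!}=\frac{2\exp(tx)}{\exp(t)+1}$, and let $E_j=2^jE_j(1/2)$ denote the $j$-th Euler number. A nontrivial decomposition of $f\in\mathbb{C}[x]$ is a pair $(g,h)$ of polynomials in $\mathbb{C}[x]$, both of degree at least $2$, with $f=g\circ h$. A polynomial $f\in\mathbb{C}[x]$ is indecomposable (over $\mathbb{C}$) if $\deg f\ge 2$ and $f$ has no nontrivial decomposition. Two decompositions $g_1\circ h_1=g_2\circ h_2$ are equivalent if there is a polynomial $\ell\in\mathbb{C}[x]$ of degree $1$ with $g_2=g_1\circ\ell$ and $h_1=\ell\circ h_2$. (i) For every odd $k\ge 3$ the Euler polynomial $E_k(x)$ is indecomposable over $\mathbb{C}$. (ii) For every even $k=2m\ge 0$ one has $$E_k(x)=\widetilde{E}_m\Bigl(\bigl(x-\tfrac12\bigr)^2\Bigr),\qquad \widetilde{E}_m(x)=\sum_{j=0}^{m}\binom{2m}{2j}\frac{E_{2j}}{4^{j}}\,x^{m-j},$$ and every nontrivial decomposition of $E_k(x)$ over $\mathbb{C}$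 is equivalent to this one. (iii) For every $m\ge 2$ the polynomial $\widetilde{E}_m(x)$ is indecomposable over $\mathbb{C}$. -/

import Mathlib

open Polynomial

noncomputable section

/-- The number `2` as a unit of `ℚ[X]`. -/
def twoUnit : (ℚ[X])ˣ :=
  Units.map (C : ℚ →+* ℚ[X]).toMonoidHom (Units.mk0 2 two_ne_zero)

/-- The generating function `2 exp(t x) / (exp t + 1)`, as a power series in `t`
over the polynomial ring `ℚ[x]`. -/
def eulerGenFun : PowerSeries ℚ[X] :=
  2 * PowerSeries.rescale (X : ℚ[X]) (PowerSeries.exp ℚ[X]) *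
    PowerSeries.invOfUnit (PowerSeries.exp ℚ[X] + 1) twoUnit

/-- The division in the generating function is a genuine one. -/
theorem eulerGenFun_mul :
    eulerGenFun * (PowerSeries.exp ℚ[X] + 1) =
      2 * PowerSeries.rescale (X : ℚ[X]) (PowerSeries.exp ℚ[X]) := by
  have h : (PowerSeries.exp ℚ[X] + 1) *
      PowerSeries.invOfUnit (PowerSeries.exp ℚ[X] + 1) twoUnit = 1 := by
    apply PowerSeries.mul_invOfUnit
    have h2 : (C (2 : ℚ) : ℚ[X]) = 2 := map_ofNat C 2
    simp only [map_add, PowerSeries.constantCoeff_exp, map_one]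
    change (1 + 1 : ℚ[X]) = C (2 : ℚ)
    rw [h2]
    norm_num
  rw [eulerGenFun, mul_assoc, mul_comm (PowerSeries.invOfUnit _ _), h, mul_one]

/-- The `k`-th Euler polynomial: `∑ E_k(x) t^k / k! = 2 exp(t x) / (exp t + 1)`. -/
def eulerPoly (k : ℕ) : ℚ[X] :=
  C (k.factorial : ℚ) * PowerSeries.coeff k eulerGenFun

/-- The `j`-th Euler number `E_j = 2^j E_j(1/2)`. -/
def eulerNumber (j : ℕ) : ℚ :=
  2 ^ j * (eulerPoly j).eval (1 / 2)

/-- The polynomial `Ẽ_m(x) = ∑_{j=0}^m (2m choose 2j) (E_{2j} / 4^j) x^(m-j)`. -/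
def eulerTilde (m : ℕ) : ℚ[X] :=
  ∑ j ∈ Finset.range (m + 1),
    C (((2 * m).choose (2 * j) : ℚ) * (eulerNumber (2 * j) / 4 ^ j)) * X ^ (m - j)

/-- The Euler polynomial `E_k` regarded as a complex polynomial. -/
def eulerPolyC (k : ℕ) : ℂ[X] := (eulerPoly k).map (algebraMap ℚ ℂ)

/-- The polynomial `Ẽ_m` regarded as a complex polynomial. -/
def eulerTildeC (m : ℕ) : ℂ[X] := (eulerTilde m).map (algebraMap ℚ ℂ)

end

/-- `(g, h)` is a nontrivial decomposition of `f` over `K`: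
`f = g ∘ h` with `g` and `h` of degree at least `2`. -/
def IsNontrivialDecomposition {K : Type*} [Field K] (f g h : K[X]) : Prop :=
  f = g.comp h ∧ 2 ≤ g.natDegree ∧ 2 ≤ h.natDegree

/-- `f` is indecomposable over `K`: it has degree at least `2` and no nontrivial
decomposition over `K`. -/
def IsIndecomposable {K : Type*} [Field K] (f : K[X]) : Prop :=
  2 ≤ f.natDegree ∧ ∀ g h : K[X], ¬ IsNontrivialDecomposition f g h

/-- The decompositions `g₁ ∘ h₁` and `g₂ ∘ h₂` are equivalent over `K`: there is a polynomial
`ℓ` of degree one with `g₂ = g₁ ∘ ℓ` and `h₁ = ℓ ∘ h₂`. -/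
def EquivalentDecompositions {K : Type*} [Field K] (g₁ h₁ g₂ h₂ : K[X]) : Prop :=
  ∃ l : K[X], l.natDegree = 1 ∧ g₂ = g₁.comp l ∧ h₁ = l.comp h₂

/-! Centre the Euler polynomial: f(y) = E_k(y + 1/2) is monic of degree k, with second coefficient 0
and third -k(k-1)/8. Subtracting two instances of the difference equation gives f(y+1) - f(y-1) =
2((y+1/2)^k - (y-1/2)^k), whose zeros are purely imaginary.

Suppose f = g ∘ h with deg g ≥ 2 and d = deg h ≥ 3. Every zero of q(y) = h(y+1) - h(y-1) is a zero
of f(y+1) - f(y-1), hence purely imaginary. As the second coefficient of q is 0, Vieta makes the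
ratio of its third coefficient to the leading one nonnegative. But the top three coefficients of f
determine those of h up to scaling, and with k ≥ 2d this ratio comes out negative. So d = 2
(`natDegree_lt_three_of_eq_comp`).

The rest is bookkeeping: k must be even, the vanishing second coefficient forces h to be a linear
polynomial in (x - 1/2)^2, and a decomposition of Ẽ_m would give E_{2m} an inner factor of degree at
least 4. -/

/-! ### Identities from the generating function -/

theorem map_rescale_exp {A B : Type*} [CommRing A] [CommRing B] [Algebra ℚ A] [Algebra ℚ B]
    (f : A →+* B) (a : A) :
    PowerSeries.map f (PowerSeries.rescale a (PowerSeries.exp A)) =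
      PowerSeries.rescale (f a) (PowerSeries.exp B) := by
  ext n
  rw [PowerSeries.coeff_map, PowerSeries.coeff_rescale, PowerSeries.coeff_rescale, map_mul,
    map_pow, ← PowerSeries.coeff_map, PowerSeries.map_exp]

theorem exp_add_one_ne_zero : PowerSeries.exp ℚ[X] + 1 ≠ 0 := by
  intro h
  have := congrArg PowerSeries.constantCoeff h
  simp only [map_add, PowerSeries.constantCoeff_exp, map_one, map_zero] at this
  norm_num at this

/-- Substituting q for x leaves the factor exp t + 1 unchanged. Since that factor is cancellable,
identities between the E_k ∘ q reduce to identities between exponentials. -/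
theorem map_compRingHom_eulerGenFun_mul (q : ℚ[X]) :
    PowerSeries.map (compRingHom q) eulerGenFun * (PowerSeries.exp ℚ[X] + 1) =
      2 * PowerSeries.rescale q (PowerSeries.exp ℚ[X]) := by
  have h := congrArg (PowerSeries.map (compRingHom q)) eulerGenFun_mul
  simpa only [map_mul, map_add, map_one, PowerSeries.map_exp, map_ofNat, map_rescale_exp,
    coe_compRingHom_apply, X_comp] using h

theorem factorial_mul_coeff_rescale_exp (q : ℚ[X]) (n : ℕ) :
    C (n.factorial : ℚ) * PowerSeries.coeff n (PowerSeries.rescale q (PowerSeries.exp ℚ[X])) =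
      q ^ n := by
  rw [PowerSeries.coeff_rescale, PowerSeries.coeff_exp, mul_left_comm, algebraMap_eq, ← C_mul,
    mul_one_div_cancel (by positivity), C_1, mul_one]

theorem factorial_mul_coeff_map_eulerGenFun (q : ℚ[X]) (n : ℕ) :
    C (n.factorial : ℚ) * PowerSeries.coeff n (PowerSeries.map (compRingHom q) eulerGenFun) =
      (eulerPoly n).comp q := by
  rw [PowerSeries.coeff_map, eulerPoly, mul_comp, C_comp, coe_compRingHom_apply]

/-- The difference equation `E_k(x + 1) + E_k(x) = 2 x^k`. -/
theorem eulerPoly_comp_X_add_one_add (k : ℕ) :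
    (eulerPoly k).comp (X + 1) + eulerPoly k = 2 * X ^ k := by
  have h : PowerSeries.map (compRingHom (X + 1)) eulerGenFun + eulerGenFun =
      2 * PowerSeries.rescale (X : ℚ[X]) (PowerSeries.exp ℚ[X]) := by
    refine mul_right_cancel₀ exp_add_one_ne_zero ?_
    rw [add_mul, map_compRingHom_eulerGenFun_mul, eulerGenFun_mul,
      ← PowerSeries.exp_mul_exp_eq_exp_add X 1, PowerSeries.rescale_one, RingHom.id_apply]
    ring
  have h' := congrArg (fun F ↦ C (k.factorial : ℚ) * PowerSeries.coeff k F) h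
  simp only [map_add, mul_add, factorial_mul_coeff_map_eulerGenFun, two_mul,
    factorial_mul_coeff_rescale_exp] at h'
  rw [two_mul, ← h', eulerPoly]

/-- The Appell property `E_k(p + q) = ∑ (k choose j) E_j(p) q^(k-j)`. -/
theorem eulerPoly_comp_add (k : ℕ) (p q : ℚ[X]) :
    (eulerPoly k).comp (p + q) =
      ∑ j ∈ Finset.range (k + 1), C (k.choose j : ℚ) * (eulerPoly j).comp p * q ^ (k - j) := by
  have h : PowerSeries.map (compRingHom (p + q)) eulerGenFun =
      PowerSeries.map (compRingHom p) eulerGenFun *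
        PowerSeries.rescale q (PowerSeries.exp ℚ[X]) := by
    refine mul_right_cancel₀ exp_add_one_ne_zero ?_
    rw [map_compRingHom_eulerGenFun_mul, mul_right_comm, map_compRingHom_eulerGenFun_mul,
      mul_assoc, PowerSeries.exp_mul_exp_eq_exp_add]
  rw [← factorial_mul_coeff_map_eulerGenFun, h, PowerSeries.coeff_mul,
    Finset.Nat.sum_antidiagonal_eq_sum_range_succ_mk, Finset.mul_sum]
  refine Finset.sum_congr rfl fun j hj ↦ ?_
  have hjk : j ≤ k := Nat.lt_succ_iff.mp (Finset.mem_range.mp hj)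
  rw [← factorial_mul_coeff_map_eulerGenFun, ← factorial_mul_coeff_rescale_exp,
    ← Nat.choose_mul_factorial_mul_factorial hjk]
  push_cast [C_mul]
  ring

/-- The reflection formula `E_k(1 - x) = (-1)^k E_k(x)`. -/
theorem eulerPoly_comp_one_sub_X (k : ℕ) :
    (eulerPoly k).comp (1 - X) = (-1) ^ k * eulerPoly k := by
  have hexp : PowerSeries.exp ℚ[X] = PowerSeries.rescale (1 : ℚ[X]) (PowerSeries.exp ℚ[X]) := by
    rw [PowerSeries.rescale_one, RingHom.id_apply]
  -- Replacing t by -t gives 2 exp(-tx) / (exp(-t) + 1); multiplying numerator and denominator by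
  -- exp t turns it into 2 exp(t(1 - x)) / (exp t + 1).
  have h : PowerSeries.map (compRingHom (1 - X)) eulerGenFun =
      PowerSeries.rescale (-1 : ℚ[X]) eulerGenFun := by
    refine mul_right_cancel₀ exp_add_one_ne_zero ?_
    have h1 := congrArg (PowerSeries.rescale (-1 : ℚ[X])) eulerGenFun_mul
    simp only [map_mul, map_add, map_one, map_ofNat, PowerSeries.rescale_rescale] at h1
    have h2 : PowerSeries.rescale (-1 : ℚ[X]) (PowerSeries.exp ℚ[X]) * PowerSeries.exp ℚ[X] =
        1 := by
      conv_lhs => rw [hexp, PowerSeries.rescale_rescale, PowerSeries.exp_mul_exp_eq_exp_add]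
      simp
    have h3 : PowerSeries.rescale (X * -1 : ℚ[X]) (PowerSeries.exp ℚ[X]) * PowerSeries.exp ℚ[X] =
        PowerSeries.rescale (1 - X : ℚ[X]) (PowerSeries.exp ℚ[X]) := by
      conv_lhs => rw [← RingHom.id_apply (PowerSeries.exp ℚ[X]), ← PowerSeries.rescale_one]
      rw [PowerSeries.rescale_rescale, PowerSeries.exp_mul_exp_eq_exp_add]
      congr 2
      ring
    rw [map_compRingHom_eulerGenFun_mul]
    linear_combination (-2) * h3 - PowerSeries.exp ℚ[X] * h1 +
      PowerSeries.rescale (-1 : ℚ[X]) eulerGenFun * h2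
  rw [← factorial_mul_coeff_map_eulerGenFun, h, PowerSeries.coeff_rescale, eulerPoly]
  ring

/-! ### Expansion about the centre of symmetry 1/2 -/

theorem eulerPoly_eval_half_of_odd {k : ℕ} (hk : Odd k) : (eulerPoly k).eval (1 / 2) = 0 := by
  have h := congrArg (eval (1 / 2 : ℚ)) (eulerPoly_comp_one_sub_X k)
  rw [hk.neg_one_pow] at h
  simp only [eval_comp, eval_sub, eval_one, eval_X, neg_mul, one_mul, eval_neg] at h
  norm_num at h
  norm_num
  linarith

/-- The expansion of the Euler polynomial at `1/2`. -/
theorem eulerPoly_comp_X_add_half (k : ℕ) :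
    (eulerPoly k).comp (X + C (1 / 2)) =
      ∑ j ∈ Finset.range (k + 1),
        C ((k.choose j : ℚ) * (eulerPoly j).eval (1 / 2)) * X ^ (k - j) := by
  rw [add_comm, eulerPoly_comp_add]
  simp only [comp_C, C_mul]

theorem coeff_eulerPoly_comp_X_add_half (k j : ℕ) (hj : j ≤ k) :
    ((eulerPoly k).comp (X + C (1 / 2))).coeff (k - j) =
      (k.choose j : ℚ) * (eulerPoly j).eval (1 / 2) := by
  rw [eulerPoly_comp_X_add_half, finsetSum_coeff, Finset.sum_eq_single j]
  · rw [coeff_C_mul_X_pow, if_pos rfl]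
  · intro i hi hij
    rw [coeff_C_mul_X_pow, if_neg]
    have := Finset.mem_range.mp hi
    omega
  · intro h
    simp at h
    omega

theorem natDegree_eulerPoly_comp_X_add_half_le (k : ℕ) :
    ((eulerPoly k).comp (X + C (1 / 2))).natDegree ≤ k := by
  rw [eulerPoly_comp_X_add_half]
  refine natDegree_sum_le_of_forall_le _ _ fun j _ ↦ ?_
  exact (natDegree_C_mul_X_pow_le _ _).trans (Nat.sub_le _ _)

theorem eulerPoly_zero : eulerPoly 0 = 1 := by
  have h : eulerPoly 0 = C ((eulerPoly 0).coeff 0) := by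
    have h0 := natDegree_eulerPoly_comp_X_add_half_le 0
    rw [natDegree_comp, natDegree_X_add_C, mul_one] at h0
    exact eq_C_of_natDegree_le_zero h0
  have h1 := eulerPoly_comp_X_add_one_add 0
  rw [h, C_comp, pow_zero, mul_one, ← C_add] at h1
  have h2 := congrArg (eval 0) h1
  simp only [eval_C, eval_ofNat] at h2
  rw [h, show (eulerPoly 0).coeff 0 = 1 by linarith, C_1]

theorem eulerPoly_two_eval_half : (eulerPoly 2).eval (1 / 2) = -1 / 4 := by
  -- The two evaluations read E_2(1/2) + E_2(-1/2) = 1/2 and E_2(-1/2) = 1 + E_2(1/2).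
  have h := congrArg (eval (-1 / 2 : ℚ)) (eulerPoly_comp_X_add_one_add 2)
  have h1 := congrArg (eval (-1 : ℚ)) (eulerPoly_comp_X_add_half 2)
  simp only [Finset.sum_range_succ, Finset.sum_range_zero, eulerPoly_zero,
    eulerPoly_eval_half_of_odd odd_one, eval_comp, eval_add, eval_mul, eval_C, eval_pow, eval_X,
    eval_one, eval_ofNat] at h h1
  norm_num at h h1 ⊢
  linarith

theorem sum_range_two_mul_add_one_of_odd_eq_zero {M : Type*} [AddCommMonoid M] (a : ℕ → M)
    (ha : ∀ i, Odd i → a i = 0) (m : ℕ) :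
    ∑ i ∈ Finset.range (2 * m + 1), a i = ∑ j ∈ Finset.range (m + 1), a (2 * j) := by
  induction m with
  | zero => simp
  | succ m ih =>
    rw [show 2 * (m + 1) + 1 = 2 * m + 1 + 1 + 1 by ring, Finset.sum_range_succ,
      Finset.sum_range_succ, ih, ha _ ⟨m, rfl⟩, add_zero, Finset.sum_range_succ _ (m + 1)]
    rfl

theorem eulerPoly_two_mul_comp_X_add_half (m : ℕ) :
    (eulerPoly (2 * m)).comp (X + C (1 / 2)) = (eulerTilde m).comp (X ^ 2) := by
  rw [eulerPoly_comp_X_add_half, sum_range_two_mul_add_one_of_odd_eq_zero, eulerTilde,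
    ← coe_compRingHom_apply, map_sum]
  · refine Finset.sum_congr rfl fun j _ ↦ ?_
    rw [coe_compRingHom_apply, mul_comp, C_comp, pow_comp, X_comp, ← pow_mul, eulerNumber,
      ← Nat.mul_sub, pow_mul 2 2 j,
      show (2 : ℚ) ^ 2 = 4 by norm_num, mul_div_cancel_left₀ _ (by positivity)]
  · intro i hi
    rw [eulerPoly_eval_half_of_odd hi, mul_zero, C_0, zero_mul]

/-! ### Leading coefficients of powers, compositions and translates -/

section TopCoefficients

variable {R : Type*} [CommRing R]

theorem coeff_zero_of_pow (q : R[X]) (n : ℕ) : (q ^ n).coeff 0 = q.coeff 0 ^ n := by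
  simp only [coeff_zero_eq_eval_zero, eval_pow]

theorem coeff_two_mul (p q : R[X]) :
    (p * q).coeff 2 = p.coeff 0 * q.coeff 2 + p.coeff 1 * q.coeff 1 + p.coeff 2 * q.coeff 0 := by
  rw [coeff_mul, Finset.Nat.sum_antidiagonal_eq_sum_range_succ_mk]
  simp [Finset.sum_range_succ]

theorem coeff_one_pow (q : R[X]) (n : ℕ) :
    (q ^ (n + 1)).coeff 1 = (n + 1) * q.coeff 0 ^ n * q.coeff 1 := by
  induction n with
  | zero => simp
  | succ n ih =>
    rw [pow_succ, mul_coeff_one, ih, coeff_zero_of_pow]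
    push_cast
    ring

theorem coeff_two_pow_of_coeff_one_eq_zero {q : R[X]} (hq : q.coeff 1 = 0) (n : ℕ) :
    (q ^ (n + 1)).coeff 2 = (n + 1) * q.coeff 0 ^ n * q.coeff 2 := by
  induction n with
  | zero => simp
  | succ n ih =>
    rw [pow_succ, coeff_two_mul, ih, coeff_zero_of_pow, hq]
    push_cast
    ring

/-- Reflection turns top coefficients into bottom ones, so the formulas for the coefficients of a
power in degrees 0, 1, 2 apply to its leading terms. -/
theorem reflect_pow {p : R[X]} {d : ℕ} (hp : p.natDegree ≤ d) (n : ℕ) :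
    reflect (n * d) (p ^ n) = reflect d p ^ n := by
  induction n with
  | zero => simp [reflect_one]
  | succ n ih =>
    rw [add_mul, one_mul, pow_succ, reflect_mul _ _ (natDegree_pow_le_of_le n hp) hp, ih, pow_succ]

theorem coeff_reflect_of_le (p : R[X]) {n i : ℕ} (hi : i ≤ n) :
    (reflect n p).coeff i = p.coeff (n - i) := by
  rw [coeff_reflect, revAt_le hi]

/-- The coefficients of `g ∘ h` in degrees above `(deg g - 1) * deg h` are those of
`a * h ^ deg g`, with `a` the leading coefficient of `g`. -/
theorem coeff_comp_of_lt {g h : R[X]} {e d n : ℕ} (hg : g.natDegree = e + 1)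
    (hh : h.natDegree ≤ d) (hn : e * d < n) :
    (g.comp h).coeff n = g.coeff (e + 1) * (h ^ (e + 1)).coeff n := by
  rw [comp_eq_sum_left, sum_over_range _ (by simp), hg, Finset.sum_range_succ, coeff_add,
    coeff_C_mul, coeff_eq_zero_of_natDegree_lt, zero_add]
  refine (natDegree_sum_le_of_forall_le (n := e * d) _ _ fun i hi ↦ ?_).trans_lt hn
  refine (natDegree_C_mul_le _ _).trans ((natDegree_pow_le_of_le i hh).trans ?_)
  exact Nat.mul_le_mul_right d (Nat.lt_succ_iff.mp (Finset.mem_range.mp hi))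

theorem coeff_taylor_of_natDegree_le {h : R[X]} {n : ℕ} (hh : h.natDegree ≤ n + 3) (r : R) :
    (taylor r h).coeff n = h.coeff n + (n + 1) * r * h.coeff (n + 1) +
      ((n + 2).choose 2 : ℕ) * r ^ 2 * h.coeff (n + 2) +
      ((n + 3).choose 3 : ℕ) * r ^ 3 * h.coeff (n + 3) := by
  have h1 : (hasseDeriv n h).natDegree < 4 := by
    have := natDegree_hasseDeriv_le h n
    omega
  rw [taylor_coeff, eval_eq_sum_range' h1]
  simp only [Finset.sum_range_succ, Finset.sum_range_zero, hasseDeriv_coeff]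
  rw [add_comm 3 n, add_comm 2 n, add_comm 1 n, zero_add n, Nat.choose_self,
    Nat.choose_symm_add, Nat.choose_symm_add, Nat.choose_symm_add, Nat.choose_one_right]
  push_cast
  ring

end TopCoefficients

/-! ### Purely imaginary roots and the bound on the inner degree -/

/-- For roots i t_j, Vieta gives a = -∑ t_j and b = e_2(i t_j), so 2b + a² = ∑ t_j². This form of
the inequality is stable under adjoining a root. -/
theorem exists_coeff_reflect_prod_of_re_eq_zero (s : Multiset ℂ) (hs : ∀ r ∈ s, r.re = 0) :
    ∃ a b : ℝ, (reflect s.card (s.map fun r ↦ (X - C r : ℂ[X])).prod).coeff 0 = 1 ∧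
      (reflect s.card (s.map fun r ↦ (X - C r : ℂ[X])).prod).coeff 1 = a * Complex.I ∧
      (reflect s.card (s.map fun r ↦ (X - C r : ℂ[X])).prod).coeff 2 = b ∧ 0 ≤ 2 * b + a ^ 2 := by
  induction s using Multiset.induction_on with
  | empty => exact ⟨0, 0, by simp [reflect_one, coeff_one]⟩
  | cons r s ih =>
    obtain ⟨a, b, h0, h1, h2, h3⟩ := ih fun t ht ↦ hs t (Multiset.mem_cons_of_mem ht)
    have hr : r = r.im * Complex.I := by
      apply Complex.ext <;> simp [hs r (Multiset.mem_cons_self r s)]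
    have hdeg : (s.map fun r ↦ (X - C r : ℂ[X])).prod.natDegree ≤ s.card := by
      rw [natDegree_multiset_prod_X_sub_C_eq_card]
    have hc0 : (reflect 1 (X - C r)).coeff 0 = 1 := by
      rw [coeff_reflect_of_le _ zero_le_one]; simp [coeff_C]
    have hc1 : (reflect 1 (X - C r)).coeff 1 = -r := by
      rw [coeff_reflect_of_le _ le_rfl]; simp
    have hc2 : (reflect 1 (X - C r)).coeff 2 = 0 := by
      rw [coeff_reflect, revAt_eq_self_of_lt (by norm_num), coeff_eq_zero_of_natDegree_lt]
      rw [natDegree_X_sub_C]; norm_num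
    rw [Multiset.map_cons, Multiset.prod_cons, Multiset.card_cons, mul_comm,
      reflect_mul _ _ hdeg (natDegree_X_sub_C r).le, mul_coeff_zero, mul_coeff_one, coeff_two_mul,
      h0, h1, h2, hc0, hc1, hc2]
    refine ⟨a - r.im, b + a * r.im, by ring, ?_, ?_, by nlinarith [sq_nonneg r.im]⟩
    · rw [hr]; push_cast; simp; ring
    · rw [hr]; push_cast; simp
      linear_combination (-(a : ℂ) * r.im) * Complex.I_sq

/-- If all roots of `q` are purely imaginary and its second coefficient vanishes, the ratio of the
third coefficient to the leading one is a nonnegative real. -/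
theorem exists_nonneg_coeff_eq_of_re_root_eq_zero {q : ℂ[X]} {n : ℕ} (hn : q.natDegree = n + 2)
    (hq : ∀ z, q.IsRoot z → z.re = 0) (h1 : q.coeff (n + 1) = 0) :
    ∃ b : ℝ, 0 ≤ b ∧ q.coeff n = q.leadingCoeff * b := by
  have hq0 : q ≠ 0 := by rintro rfl; simp at hn
  have hlc : q.leadingCoeff ≠ 0 := leadingCoeff_ne_zero.mpr hq0
  have hsplit := IsAlgClosed.splits q
  have hcard : q.roots.card = n + 2 := by rw [← hn, hsplit.natDegree_eq_card_roots]
  obtain ⟨a, b, -, ha, hb, hab⟩ := exists_coeff_reflect_prod_of_re_eq_zero q.roots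
    fun r hr ↦ hq r (isRoot_of_mem_roots hr)
  rw [hcard, coeff_reflect_of_le _ (by omega)] at ha hb
  have e1 := congrArg (coeff · (n + 1)) hsplit.eq_prod_roots
  have e2 := congrArg (coeff · n) hsplit.eq_prod_roots
  simp only [coeff_C_mul] at e1 e2
  rw [show n + 2 - 1 = n + 1 by omega] at ha
  rw [Nat.add_sub_cancel] at hb
  rw [h1, ha] at e1
  rw [hb] at e2
  have ha0 : a = 0 := by
    simpa [hlc] using e1.symm
  subst ha0
  exact ⟨b, by linarith, e2⟩

/-- Taking absolute values, z is equidistant from 1/2 and -1/2. -/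
theorem re_eq_zero_of_add_half_pow_eq {k : ℕ} (hk : k ≠ 0) {z : ℂ}
    (hz : (z + 1 / 2) ^ k = (z - 1 / 2) ^ k) : z.re = 0 := by
  have h := congrArg (fun w ↦ ‖w‖) hz
  simp only [norm_pow] at h
  have h1 := (pow_left_inj₀ (norm_nonneg _) (norm_nonneg _) hk).mp h
  have h2 := congrArg (· ^ 2) h1
  simp only [Complex.sq_norm, Complex.normSq_apply] at h2
  norm_num at h2
  linarith

/-- A polynomial `f = y^k - k(k-1)/8 y^(k-2) + ⋯` with
`f(y + 1) - f(y - 1) = 2 ((y + 1/2)^k - (y - 1/2)^k)` is not of the form `g ∘ h` with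
`deg g ≥ 2` and `deg h ≥ 3`. -/
theorem natDegree_lt_three_of_eq_comp {k : ℕ} {f g h : ℂ[X]} (hfgh : f = g.comp h)
    (hdeg : f.natDegree = k) (hg : 2 ≤ g.natDegree) (hf0 : f.coeff k = 1)
    (hf1 : f.coeff (k - 1) = 0) (hf2 : f.coeff (k - 2) = -(k * (k - 1)) / 8)
    (hdiff : ∀ z, f.eval (z + 1) - f.eval (z - 1) = 2 * ((z + 1 / 2) ^ k - (z - 1 / 2) ^ k)) :
    h.natDegree < 3 := by
  by_contra! hh
  obtain ⟨n, hn⟩ := Nat.exists_eq_add_of_le' hh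
  obtain ⟨e, he⟩ := Nat.exists_eq_add_of_le' (one_le_two.trans hg)
  have hk : k = (e + 1) * (n + 3) := by rw [← hdeg, hfgh, natDegree_comp, he, hn]
  have he1 : 1 ≤ e := by omega
  have hk' : k = e * (n + 3) + (n + 3) := by rw [hk]; ring
  -- Here deg h ≥ 3 is essential: the degrees k, k - 1, k - 2 all exceed e(n + 3), so only the
  -- leading term of g contributes.
  have htop : ∀ i ≤ 2, f.coeff (k - i) =
      g.coeff (e + 1) * ((reflect (n + 3) h) ^ (e + 1)).coeff i := by
    intro i hi
    rw [hfgh, coeff_comp_of_lt he hn.le (by omega), ← reflect_pow hn.le,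
      coeff_reflect_of_le _ (by rw [← hk]; omega), hk]
  have h0 : (reflect (n + 3) h).coeff 0 = h.coeff (n + 3) := coeff_reflect_of_le _ (by omega)
  have h1 : (reflect (n + 3) h).coeff 1 = h.coeff (n + 2) := coeff_reflect_of_le _ (by omega)
  have h2 : (reflect (n + 3) h).coeff 2 = h.coeff (n + 1) := coeff_reflect_of_le _ (by omega)
  have t0 := htop 0 (by norm_num)
  have t1 := htop 1 (by norm_num)
  have t2 := htop 2 le_rfl
  rw [Nat.sub_zero, hf0, coeff_zero_of_pow, h0] at t0
  rw [hf1, coeff_one_pow, h0, h1] at t1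
  have hγ : g.coeff (e + 1) ≠ 0 := left_ne_zero_of_mul (t0 ▸ one_ne_zero)
  have ha : h.coeff (n + 3) ≠ 0 := by
    intro ha
    rw [ha, zero_pow (Nat.succ_ne_zero e), mul_zero] at t0
    exact one_ne_zero t0
  have he0 : (e + 1 : ℂ) ≠ 0 := by exact_mod_cast Nat.succ_ne_zero e
  have ha1 : h.coeff (n + 2) = 0 := by
    simpa [hγ, ha, he0] using t1.symm
  rw [hf2, coeff_two_pow_of_coeff_one_eq_zero (h1.trans ha1), h0, h2] at t2
  have ha2 : h.coeff (n + 1) = -((n + 3) * (k - 1)) / 8 * h.coeff (n + 3) := by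
    have hkc : (k : ℂ) = (e + 1) * (n + 3) := by rw [hk]; push_cast; ring
    apply mul_left_cancel₀ he0
    rw [pow_succ] at t0
    linear_combination ((e + 1) * h.coeff (n + 1)) * t0 - h.coeff (n + 3) * t2 -
      (k - 1) / 8 * h.coeff (n + 3) * hkc
  have hz : ∀ i, n + 3 < i → h.coeff i = 0 := fun i hi ↦
    coeff_eq_zero_of_natDegree_lt (hn.trans_lt hi)
  set q := taylor 1 h - taylor (-1) h with hq
  have q3 : ∀ i, n + 2 < i → q.coeff i = 0 := by
    intro i hi
    rw [hq, coeff_sub, coeff_taylor_of_natDegree_le (by omega),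
      coeff_taylor_of_natDegree_le (by omega), hz (i + 1) (by omega), hz (i + 2) (by omega),
      hz (i + 3) (by omega)]
    ring
  have q2 : q.coeff (n + 2) = 2 * (n + 3) * h.coeff (n + 3) := by
    rw [hq, coeff_sub, coeff_taylor_of_natDegree_le (by omega),
      coeff_taylor_of_natDegree_le (by omega), hz (n + 2 + 2) (by omega),
      hz (n + 2 + 3) (by omega)]
    push_cast
    ring
  have q1 : q.coeff (n + 1) = 0 := by
    rw [hq, coeff_sub, coeff_taylor_of_natDegree_le (by omega),
      coeff_taylor_of_natDegree_le (by omega), hz (n + 1 + 3) (by omega),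
      show n + 1 + 1 = n + 2 by rfl, ha1]
    ring
  have hch : ((n + 3).choose 3 : ℂ) = (n + 3) * (n + 2) * (n + 1) / 6 := by
    have := Nat.add_one_mul_choose_eq (n + 2) 2
    have h' := Nat.add_one_mul_choose_eq (n + 1) 1
    have c1 : ((n : ℂ) + 3) * (n + 2).choose 2 = (n + 3).choose 3 * 3 := by exact_mod_cast this
    have c2 : ((n : ℂ) + 2) * (n + 1) = (n + 2).choose 2 * 2 := by
      rw [Nat.choose_one_right] at h'; exact_mod_cast h'
    linear_combination (-1 / 3) * c1 - (n + 3) / 6 * c2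
  have q0 : q.coeff n = 2 * (n + 1) * h.coeff (n + 1) +
      (n + 3) * (n + 2) * (n + 1) / 3 * h.coeff (n + 3) := by
    rw [hq, coeff_sub, coeff_taylor_of_natDegree_le hn.le, coeff_taylor_of_natDegree_le hn.le, hch]
    ring
  have hn3 : (n + 3 : ℂ) ≠ 0 := by exact_mod_cast Nat.succ_ne_zero (n + 2)
  have hqdeg : q.natDegree = n + 2 := by
    refine natDegree_eq_of_le_of_coeff_ne_zero (natDegree_le_iff_coeff_eq_zero.mpr q3) ?_
    rw [q2]
    simp [ha, hn3]
  -- A root z of q satisfies h(z + 1) = h(z - 1), hence f(z + 1) = f(z - 1).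
  have hroot : ∀ z, q.IsRoot z → z.re = 0 := by
    intro z hz
    rw [IsRoot, hq, eval_sub, taylor_eval, taylor_eval, sub_eq_zero, ← sub_eq_add_neg] at hz
    have := hdiff z
    rw [hfgh, eval_comp, eval_comp, hz, sub_self] at this
    refine re_eq_zero_of_add_half_pow_eq (k := k) (by omega) ?_
    linear_combination (-1 / 2) * this
  obtain ⟨b, hb, hqb⟩ := exists_nonneg_coeff_eq_of_re_root_eq_zero hqdeg hroot q1
  rw [leadingCoeff, hqdeg, q0, q2, ha2] at hqb
  have hb' : (b : ℂ) = (n + 1) * (-(k - 1) / 8 + (n + 2) / 6) := by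
    apply mul_left_cancel₀ (mul_ne_zero hn3 ha)
    linear_combination (-1 / 2) * hqb
  have hb'' : b = (n + 1) * (-(k - 1) / 8 + (n + 2) / 6) := by
    apply Complex.ofReal_injective
    rw [hb']
    push_cast
    rfl
  -- Since k = (e + 1)(n + 3) with e ≥ 1; the second factor in the formula for b is then at most
  -- -(2n + 7)/24.
  have hkn : (k : ℝ) ≥ 2 * n + 6 := by
    have : k ≥ 2 * n + 6 := by nlinarith
    exact_mod_cast this
  have : (n + 1 : ℝ) * (-(k - 1) / 8 + (n + 2) / 6) < 0 := by
    apply mul_neg_of_pos_of_neg <;> [positivity; linarith]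
  linarith

/-! ### Decompositions of Euler polynomials over ℂ -/

theorem eulerPolyC_comp (k : ℕ) (q : ℚ[X]) :
    (eulerPolyC k).comp (q.map (algebraMap ℚ ℂ)) =
      ((eulerPoly k).comp q).map (algebraMap ℚ ℂ) := by
  rw [eulerPolyC, Polynomial.map_comp]

theorem eulerPolyC_comp_X_add_half (k : ℕ) :
    (eulerPolyC k).comp (X + C (1 / 2)) =
      ((eulerPoly k).comp (X + C (1 / 2))).map (algebraMap ℚ ℂ) := by
  rw [← eulerPolyC_comp]
  simp

theorem coeff_eulerPolyC_comp_X_add_half (k j : ℕ) (hj : j ≤ k) :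
    ((eulerPolyC k).comp (X + C (1 / 2))).coeff (k - j) =
      ((k.choose j * (eulerPoly j).eval (1 / 2) : ℚ) : ℂ) := by
  rw [eulerPolyC_comp_X_add_half, coeff_map, coeff_eulerPoly_comp_X_add_half k j hj,
    eq_ratCast]

theorem coeff_self_eulerPolyC_comp_X_add_half (k : ℕ) :
    ((eulerPolyC k).comp (X + C (1 / 2))).coeff k = 1 := by
  have := coeff_eulerPolyC_comp_X_add_half k 0 (Nat.zero_le k)
  simpa [eulerPoly_zero] using this

theorem natDegree_eulerPolyC_comp_X_add_half (k : ℕ) :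
    ((eulerPolyC k).comp (X + C (1 / 2))).natDegree = k := by
  refine natDegree_eq_of_le_of_coeff_ne_zero ?_ ?_
  · rw [eulerPolyC_comp_X_add_half]
    exact natDegree_map_le.trans (natDegree_eulerPoly_comp_X_add_half_le k)
  · rw [coeff_self_eulerPolyC_comp_X_add_half]
    exact one_ne_zero

theorem natDegree_eulerPolyC (k : ℕ) : (eulerPolyC k).natDegree = k := by
  have h := natDegree_eulerPolyC_comp_X_add_half k
  rwa [natDegree_comp, natDegree_X_add_C, mul_one] at h

theorem eulerPolyC_eval_add_one (k : ℕ) (z : ℂ) :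
    (eulerPolyC k).eval (z + 1) + (eulerPolyC k).eval z = 2 * z ^ k := by
  have h := congrArg (fun p ↦ (p.map (algebraMap ℚ ℂ)).eval z) (eulerPoly_comp_X_add_one_add k)
  simpa [eulerPolyC, Polynomial.map_comp] using h

theorem natDegree_eq_two_of_isNontrivialDecomposition {k : ℕ} {g h : ℂ[X]}
    (H : IsNontrivialDecomposition (eulerPolyC k) g h) : h.natDegree = 2 := by
  obtain ⟨hgh, hg, hh⟩ := H
  have hk : 4 ≤ k := by
    rw [← natDegree_eulerPolyC k, hgh, natDegree_comp]
    nlinarith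
  have hlt : (h.comp (X + C (1 / 2))).natDegree < 3 := by
    refine natDegree_lt_three_of_eq_comp (k := k) (f := (eulerPolyC k).comp (X + C (1 / 2)))
      (g := g) ?_ (natDegree_eulerPolyC_comp_X_add_half k) hg
      (coeff_self_eulerPolyC_comp_X_add_half k) ?_ ?_ ?_
    · rw [hgh, comp_assoc]
    · rw [coeff_eulerPolyC_comp_X_add_half k 1 (by omega), eulerPoly_eval_half_of_odd odd_one]
      simp
    · rw [coeff_eulerPolyC_comp_X_add_half k 2 (by omega), eulerPoly_two_eval_half,
        Nat.cast_choose_two]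
      push_cast
      ring
    · intro z
      have e1 := eulerPolyC_eval_add_one k (z + 1 / 2)
      have e2 := eulerPolyC_eval_add_one k (z - 1 / 2)
      simp only [eval_comp, eval_add, eval_X, eval_C]
      rw [show z + 1 / 2 + 1 = z + 1 + 1 / 2 by ring] at e1
      rw [show z - 1 / 2 + 1 = z + 1 / 2 by ring] at e2
      rw [show z - 1 + 1 / 2 = z - 1 / 2 by ring]
      linear_combination e1 - e2
  rw [natDegree_comp, natDegree_X_add_C, mul_one] at hlt
  omega

theorem eulerPolyC_two_mul_comp_X_add_half (m : ℕ) :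
    (eulerPolyC (2 * m)).comp (X + C (1 / 2)) = (eulerTildeC m).comp (X ^ 2) := by
  rw [eulerPolyC_comp_X_add_half, eulerPoly_two_mul_comp_X_add_half, Polynomial.map_comp,
    Polynomial.map_pow, map_X, eulerTildeC]

theorem comp_X_add_C_comp_X_sub_C (p : ℂ[X]) (a : ℂ) :
    (p.comp (X + C a)).comp (X - C a) = p := by
  rw [comp_assoc]
  simp

theorem eulerPolyC_two_mul (m : ℕ) :
    eulerPolyC (2 * m) = (eulerTildeC m).comp ((X - C (1 / 2 : ℂ)) ^ 2) := by
  rw [← comp_X_add_C_comp_X_sub_C (eulerPolyC (2 * m)) (1 / 2),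
    eulerPolyC_two_mul_comp_X_add_half, comp_assoc, pow_comp, X_comp]

theorem natDegree_X_sub_C_sq (a : ℂ) : ((X - C a) ^ 2).natDegree = 2 := by
  rw [natDegree_pow, natDegree_X_sub_C]

theorem natDegree_eulerTildeC (m : ℕ) : (eulerTildeC m).natDegree = m := by
  have h := natDegree_eulerPolyC (2 * m)
  rw [eulerPolyC_two_mul, natDegree_comp, natDegree_X_sub_C_sq] at h
  omega

theorem comp_left_injective_of_natDegree_pos {p : ℂ[X]} (hp : 0 < p.natDegree) {f g : ℂ[X]}
    (h : f.comp p = g.comp p) : f = g := by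
  rw [← sub_eq_zero, ← sub_comp, comp_eq_zero_iff] at h
  rcases h with h | ⟨-, h⟩
  · exact sub_eq_zero.mp h
  · rw [h, natDegree_C] at hp
    exact absurd hp (lt_irrefl 0)

/-- If Ẽ_m = g ∘ u, then E_{2m} has the inner factor u((x - 1/2)²), of degree 2 deg u ≥ 4 instead of
2. -/
theorem isIndecomposable_eulerTildeC {m : ℕ} (hm : 2 ≤ m) : IsIndecomposable (eulerTildeC m) := by
  refine ⟨(natDegree_eulerTildeC m).symm ▸ hm, fun g u ⟨hgu, hg, hu⟩ ↦ ?_⟩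
  have hdeg : (u.comp ((X - C (1 / 2 : ℂ)) ^ 2)).natDegree = u.natDegree * 2 := by
    rw [natDegree_comp, natDegree_X_sub_C_sq]
  have := natDegree_eq_two_of_isNontrivialDecomposition (k := 2 * m) (g := g)
    (h := u.comp ((X - C (1 / 2 : ℂ)) ^ 2))
    ⟨by rw [eulerPolyC_two_mul, hgu, comp_assoc], hg, by omega⟩
  omega

theorem isIndecomposable_eulerPolyC_of_odd {k : ℕ} (hk : Odd k) (hk1 : k ≠ 1) :
    IsIndecomposable (eulerPolyC k) := by
  obtain ⟨i, hi⟩ := hk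
  refine ⟨by rw [natDegree_eulerPolyC]; omega, fun g h H ↦ ?_⟩
  have hk2 := natDegree_eulerPolyC k
  rw [H.1, natDegree_comp, natDegree_eq_two_of_isNontrivialDecomposition H] at hk2
  omega

/-- The inner polynomial of a decomposition of an Euler polynomial is symmetric about `1/2`. -/
theorem eq_comp_of_isNontrivialDecomposition {k : ℕ} {g h : ℂ[X]}
    (H : IsNontrivialDecomposition (eulerPolyC k) g h) :
    ∃ l : ℂ[X], l.natDegree = 1 ∧ h = l.comp ((X - C (1 / 2 : ℂ)) ^ 2) := by
  have hh := natDegree_eq_two_of_isNontrivialDecomposition H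
  obtain ⟨hgh, hg, -⟩ := H
  set p := h.comp (X + C (1 / 2 : ℂ)) with hp
  have hpdeg : p.natDegree = 2 := by rw [hp, natDegree_comp, natDegree_X_add_C, hh]
  obtain ⟨e, he⟩ := Nat.exists_eq_add_of_le' (one_le_two.trans hg)
  have hk : k = (e + 1) * 2 := by
    rw [← natDegree_eulerPolyC k, hgh, natDegree_comp, he, hh]
  have hp2 : p.coeff 2 ≠ 0 := by
    rw [← hpdeg]
    exact leadingCoeff_ne_zero.mpr (by rintro h0; simp [h0] at hpdeg)
  have hg0 : g.coeff (e + 1) ≠ 0 := by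
    rw [← he]
    exact leadingCoeff_ne_zero.mpr (by rintro h0; simp [h0] at he)
  -- The coefficient of degree k - 1 of E_k(x + 1/2) is 0, and it is also a nonzero multiple of
  -- `p.coeff 1`.
  have hp1 : p.coeff 1 = 0 := by
    have h1 := coeff_eulerPolyC_comp_X_add_half k 1 (by omega)
    rw [eulerPoly_eval_half_of_odd odd_one, hgh, comp_assoc,
      coeff_comp_of_lt he hpdeg.le (by omega), hk,
      ← coeff_reflect_of_le _ (by omega : 1 ≤ (e + 1) * 2), reflect_pow hpdeg.le,
      coeff_one_pow, coeff_reflect_of_le _ (by omega), coeff_reflect_of_le _ (by omega)] at h1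
    have he0 : (e + 1 : ℂ) ≠ 0 := by exact_mod_cast Nat.succ_ne_zero e
    simpa [hg0, hp2, he0] using h1
  refine ⟨C (p.coeff 2) * X + C (p.coeff 0), natDegree_linear hp2, ?_⟩
  have hpx : p = (C (p.coeff 2) * X + C (p.coeff 0)).comp (X ^ 2) := by
    conv_lhs => rw [p.as_sum_range_C_mul_X_pow, hpdeg]
    simp [Finset.sum_range_succ, hp1]
    ring
  rw [← comp_X_add_C_comp_X_sub_C h (1 / 2), ← hp]
  conv_lhs => rw [hpx]
  rw [comp_assoc, pow_comp, X_comp]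

theorem theorem1 :
    (∀ k : ℕ, Odd k → k ≠ 1 → IsIndecomposable (eulerPolyC k)) ∧
    (∀ m : ℕ,
      eulerPolyC (2 * m) = (eulerTildeC m).comp ((X - C (1 / 2 : ℂ)) ^ 2) ∧
      ∀ g h : ℂ[X], IsNontrivialDecomposition (eulerPolyC (2 * m)) g h →
        EquivalentDecompositions g h (eulerTildeC m) ((X - C (1 / 2 : ℂ)) ^ 2)) ∧
    (∀ m : ℕ, 2 ≤ m → IsIndecomposable (eulerTildeC m)) := by
  refine ⟨fun k hk hk1 ↦ isIndecomposable_eulerPolyC_of_odd hk hk1,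
    fun m ↦ ⟨eulerPolyC_two_mul m, fun g h H ↦ ?_⟩, fun m hm ↦ isIndecomposable_eulerTildeC hm⟩
  obtain ⟨l, hl, hhl⟩ := eq_comp_of_isNontrivialDecomposition H
  refine ⟨l, hl, ?_, hhl⟩
  -- Ẽ_m and g ∘ l agree after composition with (x - 1/2)², which cancels on the right because it is
  -- nonconstant.
  refine comp_left_injective_of_natDegree_pos
    (p := (X - C (1 / 2 : ℂ)) ^ 2) (by rw [natDegree_X_sub_C_sq]; norm_num) ?_
  rw [← eulerPolyC_two_mul, H.1, hhl, comp_assoc]
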